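/- Consider the two-qubit space $\mathbb{C}^2\otimes\mathbb{C}^2$ with product basis $|ij\rangle$. For $\theta\in\mathbb{R}$ let $|\Psi(\theta)\rangle=\cos\theta|01\rangle+\sin\theta|10\rangle$ and $|\Phi(\theta)\rangle=\cos\theta|00\rangle+\sin\theta|11\rangle$. Let $0<\alpha\le\beta\le\pi/4$ and $$\gamma_-:=\arctan\sqrt{\frac{\sin2\alpha}{\sin2\beta}}\ \le\ \gamma\ \le\ \gamma_+:=\arctan\sqrt{\frac{\sin2\beta}{\sin2\alpha}},$$ and put $$|\Psi_1\rangle=|\Psi(\alpha)\rangle,\quad |\Psi_2\rangle=\cos\gamma\,|\Psi(\alpha-\tfrac\pi2)\rangle+\sin\gamma\,|\Phi(\beta-\tfrac\pi2)\rangle,\quad |\Psi_3\rangle=\sin\gamma\,|\Psi(\alpha-\tfrac\pi2)\rangle-\cos\gamma\,|\Phi(\beta-\tfrac\pi2)\rangle.$$ A set of states $\rho_1,\dots,\rho_r$ is perfectly distinguishable by separable operations if there is a POVM $\{\Pi_1,\dots,\Pi_r\}$ with $\mathrm{tr}(\Pi_k\rho_j)=\delta_{kj}$ such that every $\Pi_k/\mathrm{tr}(\Pi_k)$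 is a separable state (a convex combination of pure product states). A separable operation is a map $\rho\mapsto\sum_k E_k\rho E_k^\dagger$ with $\sum_kE_k^\dagger E_k=I$ and product Kraus operators $E_k=A_k\otimes B_k$. An LOCC protocol consists of finitely many rounds; in each round one party performs a local measurement with finitely many outcomes (local ancillas allowed) and communicates its outcome, on which the rest of the protocol may depend. Then: 1. $|\Phi(\beta)\rangle$ is a unit vector, and $\{|\Psi_1\rangle,|\Psi_2\rangle,|\Psi_3\rangle\}$ is an orthonormal basis of $\{|\Phi(\beta)\rangle\}^\perp$. 2. $|\Psi_1\rangle$ is entangled; $|\Psi_2\rangle$ is a product state if and only if $\gamma=\gamma_-$; $|\Psi_3\rangle$ is a product state if and only if $\gamma=\gamma_+$. 3. $\{|\Psi_1\rangle,|\Psi_2\rangle,|\Psi_3\rangle\}$ is perfectly distinguishable by separable operations. 4. If moreover $\alpha<\beta$, then $\{|\Psi_1\rangle,|\Psi_2\rangle,|\Psi_3\rangle\}$ is not perfectly distinguishable by LOCC. In this case, for any separable states $\sigma_1,\sigma_2,\sigma_3$ on $\mathbb{C}^2\otimes\mathbb{C}^2$ that are perfectly distinguishable by LOCC, there is a separable operation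 $\mathcal{E}$ with $\mathcal{E}(|\Psi_k\rangle\langle\Psi_k|)=\sigma_k$ for $k=1,2,3$ that cannot be realized by LOCC. In particular, there exist separable operations on $\mathbb{C}^2\otimes\mathbb{C}^2$ that cannot be realized by LOCC. -/

import Mathlib

open scoped Kronecker ComplexOrder

namespace SepLOCC

/-- The state space `m ⊗ n` of a bipartite system, in the product basis `|i j⟩ = |i⟩ ⊗ |j⟩`. -/
abbrev Space (m n : ℕ) : Type := EuclideanSpace ℂ (Fin m × Fin n)

/-- Linear operators on `m ⊗ n`. -/
abbrev Op (m n : ℕ) : Type := Matrix (Fin m × Fin n) (Fin m × Fin n) ℂ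

/-- The rank one operator `|ψ⟩⟨ψ|`. -/
noncomputable def pureOp {m n : ℕ} (ψ : Space m n) : Op m n :=
  Matrix.of fun p q => ψ p * star (ψ q)

/-- `ψ = a ⊗ b` for some vectors `a`, `b`. -/
def IsProduct {m n : ℕ} (ψ : Space m n) : Prop :=
  ∃ (a : EuclideanSpace ℂ (Fin m)) (b : EuclideanSpace ℂ (Fin n)), ∀ i j, ψ (i, j) = a i * b j

/-- A separable state: a convex combination of pure product states. -/
def IsSeparableState {m n : ℕ} (ρ : Op m n) : Prop :=
  ∃ (N : ℕ) (p : Fin N → ℝ) (ψ : Fin N → Space m n),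
    (∀ k, 0 < p k) ∧ ∑ k, p k = 1 ∧ (∀ k, ‖ψ k‖ = 1 ∧ IsProduct (ψ k)) ∧
    ρ = ∑ k, (p k : ℂ) • pureOp (ψ k)

/-- A nonzero positive semidefinite operator whose normalization is a separable state. -/
def IsSeparableOp {m n : ℕ} (E : Op m n) : Prop :=
  E ≠ 0 ∧ E.PosSemidef ∧ IsSeparableState ((E.trace)⁻¹ • E)

/-- A positive operator-valued measure all of whose elements are separable. -/
def IsSeparablePOVM {m n r : ℕ} (M : Fin r → Op m n) : Prop :=
  (∀ k, IsSeparableOp (M k)) ∧ ∑ k, M k = 1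

/-- The states `ρ 0, …, ρ (r-1)` are perfectly distinguishable by separable operations. -/
def SepDistinguishable {m n r : ℕ} (ρ : Fin r → Op m n) : Prop :=
  ∃ M : Fin r → Op m n, IsSeparablePOVM M ∧
    ∀ k j, (M k * ρ j).trace = if k = j then 1 else 0

/-- A separable operation: a trace-preserving map on operators with product Kraus operators. -/
def IsSeparableOperation {m n : ℕ} (F : Op m n →ₗ[ℂ] Op m n) : Prop :=
  ∃ (N : ℕ) (A : Fin N → Matrix (Fin m) (Fin m) ℂ) (B : Fin N → Matrix (Fin n) (Fin n) ℂ),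
    ∑ k, (A k ⊗ₖ B k).conjTranspose * (A k ⊗ₖ B k) = 1 ∧
    ∀ ρ, F ρ = ∑ k, (A k ⊗ₖ B k) * ρ * (A k ⊗ₖ B k).conjTranspose

/-- `Protocol m' n' O m n` is the type of LOCC protocols, with any finite number of rounds, that
start with a bipartite system `m ⊗ n`, end with a system `m' ⊗ n'`, and announce a classical
outcome in `O`. In every round one of the two parties performs a local measurement with finitely
many outcomes, given by Kraus operators that may change the dimension of the party's own system
(so adding or discarding local ancillas is included); the outcome is communicated, and the rest of
the protocol may depend on it. Different branches may announce the same outcome. -/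
inductive Protocol (m' n' : ℕ) (O : Type) : ℕ → ℕ → Type
  | halt (o : O) : Protocol m' n' O m' n'
  | alice {m n N : ℕ} (d : Fin N → ℕ) (K : (i : Fin N) → Matrix (Fin (d i)) (Fin m) ℂ)
      (hK : ∑ i, (K i).conjTranspose * K i = 1)
      (next : (i : Fin N) → Protocol m' n' O (d i) n) : Protocol m' n' O m n
  | bob {m n N : ℕ} (d : Fin N → ℕ) (K : (i : Fin N) → Matrix (Fin (d i)) (Fin n) ℂ)
      (hK : ∑ i, (K i).conjTranspose * K i = 1)
      (next : (i : Fin N) → Protocol m' n' O m (d i)) : Protocol m' n' O m n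

/-- The unnormalized final state of the branches that announce `o`, for the initial state `ρ`.
Its trace is the probability that `o` is announced. -/
noncomputable def Protocol.run {m' n' : ℕ} {O : Type} [DecidableEq O] (o : O) :
    {m n : ℕ} → Protocol m' n' O m n → Op m n → Op m' n'
  | _, _, .halt x, ρ => if x = o then ρ else 0
  | _, n, .alice _ K _ next, ρ =>
      ∑ i, (next i).run o ((K i ⊗ₖ (1 : Matrix (Fin n) (Fin n) ℂ)) * ρ *
        (K i ⊗ₖ (1 : Matrix (Fin n) (Fin n) ℂ)).conjTranspose)
  | m, _, .bob _ K _ next, ρ =>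
      ∑ i, (next i).run o (((1 : Matrix (Fin m) (Fin m) ℂ) ⊗ₖ K i) * ρ *
        ((1 : Matrix (Fin m) (Fin m) ℂ) ⊗ₖ K i).conjTranspose)

/-- The operation `F` is realized by an LOCC protocol (whose outcome is forgotten). -/
def IsLOCC {m n : ℕ} (F : Op m n →ₗ[ℂ] Op m n) : Prop :=
  ∃ P : Protocol m n Unit m n, ∀ ρ, F ρ = P.run () ρ

/-- The states `ρ 0, …, ρ (r-1)` are perfectly distinguishable by LOCC: some LOCC protocol, run on
`ρ j`, announces `j` with probability one. -/
def LOCCDistinguishable {m n r : ℕ} (ρ : Fin r → Op m n) : Prop :=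
  ∃ (m' n' : ℕ) (P : Protocol m' n' (Fin r) m n),
    ∀ k j, (P.run k (ρ j)).trace = if k = j then 1 else 0

/-- The product basis vector `|i j⟩` of `2 ⊗ 2`. -/
noncomputable def ket (i j : Fin 2) : Space 2 2 := EuclideanSpace.single (i, j) 1

/-- `|Ψ(θ)⟩ = cos θ |01⟩ + sin θ |10⟩`. -/
noncomputable def psi (θ : ℝ) : Space 2 2 :=
  (Real.cos θ : ℂ) • ket 0 1 + (Real.sin θ : ℂ) • ket 1 0

/-- `|Φ(θ)⟩ = cos θ |00⟩ + sin θ |11⟩`. -/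
noncomputable def phi (θ : ℝ) : Space 2 2 :=
  (Real.cos θ : ℂ) • ket 0 0 + (Real.sin θ : ℂ) • ket 1 1

/-- The three states `|Ψ₁⟩, |Ψ₂⟩, |Ψ₃⟩`, indexed by `0, 1, 2`. -/
noncomputable def basisState (α β γ : ℝ) : Fin 3 → Space 2 2 :=
  ![psi α,
    (Real.cos γ : ℂ) • psi (α - Real.pi / 2) + (Real.sin γ : ℂ) • phi (β - Real.pi / 2),
    (Real.sin γ : ℂ) • psi (α - Real.pi / 2) - (Real.cos γ : ℂ) • phi (β - Real.pi / 2)]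

/-- The left end of the range of `γ`. -/
noncomputable def gammaMin (α β : ℝ) : ℝ :=
  Real.arctan (Real.sqrt (Real.sin (2 * α) / Real.sin (2 * β)))

/-- The right end of the range of `γ`. -/
noncomputable def gammaMax (α β : ℝ) : ℝ :=
  Real.arctan (Real.sqrt (Real.sin (2 * β) / Real.sin (2 * α)))

end SepLOCC

namespace SepLOCC

open Matrix

/-! Separable side. A two-qubit vector is a product exactly when the determinant of its coefficient
matrix vanishes. The range of `γ` says that every `Ψₖ` has determinant at most 0, while `Φ(β)` has
positive determinant. Hence `det (Ψₖ + t Φ)`, a real quadratic in `t`, has roots of opposite sign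
(or `Ψₖ` is itself a product), and mixing the two product vectors at the roots gives `|Ψₖ⟩⟨Ψₖ| + λₖ
|Φ⟩⟨Φ|` with `λₖ = -det Ψₖ / det Φ` (`isSeparableOp_pureOp_add`). The determinants of the `Ψₖ` add
up to `-det Φ`, so `∑ λₖ = 1` and these operators form a POVM.

LOCC side. A perfect protocol must keep the states orthogonal in every branch, so each local effect
`M = Kᴴ K` satisfies `⟨Ψₐ| M ⊗ 1 |Ψ_b⟩ = 0`, or the analogue for the other party. For `α < β` this
forces `M` to be scalar. By induction every reachable branch has only applied multiples of
isometries and has learned nothing, which is absurd when it halts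
(`kronecker_eq_zero_of_trace_run`).

Together: measure the POVM and prepare `σₖ`. If this were LOCC, appending a protocol that
discriminates the `σₖ` would discriminate the `Ψₖ`. -/

lemma pureOp_eq_vecMulVec {m n : ℕ} (ψ : Space m n) :
    pureOp ψ = vecMulVec (fun p => ψ p) (star fun p => ψ p) := rfl

lemma mul_vecMulVec_star_mul_conjTranspose {ι κ : Type*} [Fintype ι]
    (K : Matrix κ ι ℂ) (v : ι → ℂ) :
    K * vecMulVec v (star v) * Kᴴ = vecMulVec (K *ᵥ v) (star (K *ᵥ v)) := by
  rw [mul_vecMulVec, vecMulVec_mul, star_mulVec]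

lemma star_mulVec_dotProduct_mulVec {ι κ : Type*} [Fintype ι] [Fintype κ]
    (K : Matrix κ ι ℂ) (v w : ι → ℂ) :
    star (K *ᵥ v) ⬝ᵥ (K *ᵥ w) = star v ⬝ᵥ ((Kᴴ * K) *ᵥ w) := by
  rw [star_mulVec, ← dotProduct_mulVec, mulVec_mulVec]

lemma trace_vecMulVec_star {ι : Type*} [Fintype ι] (v : ι → ℂ) :
    (vecMulVec v (star v)).trace = star v ⬝ᵥ v := by
  rw [trace_vecMulVec, dotProduct_comm]

lemma sum_kronecker {ι κ ι' κ' τ : Type*} (s : Finset τ) (A : τ → Matrix ι κ ℂ)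
    (B : Matrix ι' κ' ℂ) : (∑ t ∈ s, A t) ⊗ₖ B = ∑ t ∈ s, A t ⊗ₖ B := by
  ext
  simp [Matrix.sum_apply, kroneckerMap_apply, Finset.sum_mul]

lemma kronecker_sum {ι κ ι' κ' τ : Type*} (s : Finset τ) (A : Matrix ι κ ℂ)
    (B : τ → Matrix ι' κ' ℂ) : A ⊗ₖ (∑ t ∈ s, B t) = ∑ t ∈ s, A ⊗ₖ B t := by
  ext
  simp [Matrix.sum_apply, kroneckerMap_apply, Finset.mul_sum]

/-! ### LOCC protocols on orthogonal pure states -/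

namespace Protocol

variable {m' n' : ℕ} {O : Type} [DecidableEq O]

lemma run_sum (o : O) {m n : ℕ} (P : Protocol m' n' O m n) {ι : Type} (s : Finset ι)
    (ρ : ι → Op m n) : P.run o (∑ i ∈ s, ρ i) = ∑ i ∈ s, P.run o (ρ i) := by
  induction P with
  | halt x => simp only [run]; split_ifs <;> simp
  | alice d K hK next ih =>
    simp only [run, Matrix.mul_sum, Matrix.sum_mul, ih]
    exact Finset.sum_comm
  | bob d K hK next ih =>
    simp only [run, Matrix.mul_sum, Matrix.sum_mul, ih]
    exact Finset.sum_comm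

lemma run_posSemidef (o : O) {m n : ℕ} (P : Protocol m' n' O m n) (ρ : Op m n)
    (hρ : ρ.PosSemidef) : (P.run o ρ).PosSemidef := by
  induction P with
  | halt x =>
    simp only [run]
    split_ifs
    · exact hρ
    · exact PosSemidef.zero
  | alice d K hK next ih =>
    exact posSemidef_sum _ fun i _ => ih i _ (hρ.mul_mul_conjTranspose_same _)
  | bob d K hK next ih =>
    exact posSemidef_sum _ fun i _ => ih i _ (hρ.mul_mul_conjTranspose_same _)

/-- In a round of local measurements, an outcome of probability zero has probability zero in every
branch. -/
lemma trace_run_eq_zero_of_sum {N : ℕ} {m n : Fin N → ℕ} (o : O)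
    (P : ∀ i, Protocol m' n' O (m i) (n i)) (ρ : ∀ i, Op (m i) (n i))
    (hρ : ∀ i, (ρ i).PosSemidef) (h : (∑ i, (P i).run o (ρ i)).trace = 0) (i : Fin N) :
    ((P i).run o (ρ i)).trace = 0 := by
  rw [trace_sum, Finset.sum_eq_zero_iff_of_nonneg
    fun i _ => ((P i).run_posSemidef o _ (hρ i)).trace_nonneg] at h
  exact h i (Finset.mem_univ i)

lemma sum_conjTranspose_kronecker_one {m n N : ℕ} {d : Fin N → ℕ}
    (K : (i : Fin N) → Matrix (Fin (d i)) (Fin m) ℂ) (hK : ∑ i, (K i)ᴴ * K i = 1) :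
    ∑ i, (K i ⊗ₖ (1 : Matrix (Fin n) (Fin n) ℂ))ᴴ * (K i ⊗ₖ (1 : Matrix (Fin n) (Fin n) ℂ)) = 1 := by
  simp only [conjTranspose_kronecker, ← mul_kronecker_mul, conjTranspose_one, mul_one]
  rw [← sum_kronecker, hK, one_kronecker_one]

lemma sum_conjTranspose_one_kronecker {m n N : ℕ} {d : Fin N → ℕ}
    (K : (i : Fin N) → Matrix (Fin (d i)) (Fin n) ℂ) (hK : ∑ i, (K i)ᴴ * K i = 1) :
    ∑ i, ((1 : Matrix (Fin m) (Fin m) ℂ) ⊗ₖ K i)ᴴ * ((1 : Matrix (Fin m) (Fin m) ℂ) ⊗ₖ K i) = 1 := by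
  simp only [conjTranspose_kronecker, ← mul_kronecker_mul, conjTranspose_one, mul_one]
  rw [← kronecker_sum, hK, one_kronecker_one]

/-- Pure states that are announced with certainty as two different outcomes are orthogonal. -/
lemma dotProduct_eq_zero_of_trace_run {a b : O} (hab : a ≠ b) {m n : ℕ}
    (P : Protocol m' n' O m n) (v w : Fin m × Fin n → ℂ)
    (hv : ∀ o, o ≠ a → (P.run o (vecMulVec v (star v))).trace = 0)
    (hw : ∀ o, o ≠ b → (P.run o (vecMulVec w (star w))).trace = 0) :
    star v ⬝ᵥ w = 0 := by
  induction P with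
  | halt x =>
    simp only [run] at hv hw
    -- The single announced outcome is wrong for at least one of the two states, so that state has
    -- norm zero.
    by_cases hx : x = a
    · have := hw x (hx ▸ hab)
      rw [if_pos rfl, trace_vecMulVec_star, dotProduct_star_self_eq_zero] at this
      simp [this]
    · have := hv x hx
      rw [if_pos rfl, trace_vecMulVec_star, dotProduct_star_self_eq_zero] at this
      simp [this]
  | alice d K hK next ih =>
    -- Inserting `∑ Kᴴ K = 1` splits the inner product into one term per branch.
    rw [← one_mulVec w, ← sum_conjTranspose_kronecker_one K hK, sum_mulVec, dotProduct_sum]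
    refine Finset.sum_eq_zero fun i _ => ?_
    rw [← star_mulVec_dotProduct_mulVec]
    refine ih i _ _ (fun o ho => ?_) (fun o ho => ?_) <;>
      rw [← mul_vecMulVec_star_mul_conjTranspose]
    · exact trace_run_eq_zero_of_sum o next _ (fun i =>
        (posSemidef_vecMulVec_self_star v).mul_mul_conjTranspose_same _) (hv o ho) i
    · exact trace_run_eq_zero_of_sum o next _ (fun i =>
        (posSemidef_vecMulVec_self_star w).mul_mul_conjTranspose_same _) (hw o ho) i
  | bob d K hK next ih =>
    rw [← one_mulVec w, ← sum_conjTranspose_one_kronecker K hK, sum_mulVec, dotProduct_sum]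
    refine Finset.sum_eq_zero fun i _ => ?_
    rw [← star_mulVec_dotProduct_mulVec]
    refine ih i _ _ (fun o ho => ?_) (fun o ho => ?_) <;>
      rw [← mul_vecMulVec_star_mul_conjTranspose]
    · exact trace_run_eq_zero_of_sum o next _ (fun i =>
        (posSemidef_vecMulVec_self_star v).mul_mul_conjTranspose_same _) (hv o ho) i
    · exact trace_run_eq_zero_of_sum o next _ (fun i =>
        (posSemidef_vecMulVec_self_star w).mul_mul_conjTranspose_same _) (hw o ho) i

/-- If only trivial local measurements keep the states `ψ a` orthogonal, then no protocol
discriminates them perfectly, even after the local maps `U` and `V` that are proportional to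
isometries. -/
lemma kronecker_eq_zero_of_trace_run [Nontrivial O] {p q : ℕ} (ψ : O → Fin p × Fin q → ℂ)
    (hψ : ∀ a, ψ a ≠ 0)
    (hA : ∀ M : Matrix (Fin p) (Fin p) ℂ, M.IsHermitian →
      (∀ a b, a ≠ b → star (ψ a) ⬝ᵥ ((M ⊗ₖ (1 : Matrix (Fin q) (Fin q) ℂ)) *ᵥ ψ b) = 0) →
      ∃ c : ℂ, M = c • 1)
    (hB : ∀ M : Matrix (Fin q) (Fin q) ℂ, M.IsHermitian →
      (∀ a b, a ≠ b → star (ψ a) ⬝ᵥ (((1 : Matrix (Fin p) (Fin p) ℂ) ⊗ₖ M) *ᵥ ψ b) = 0) →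
      ∃ c : ℂ, M = c • 1)
    {m n : ℕ} (P : Protocol m' n' O m n)
    (U : Matrix (Fin m) (Fin p) ℂ) (V : Matrix (Fin n) (Fin q) ℂ)
    (hU : ∃ c : ℂ, Uᴴ * U = c • 1) (hV : ∃ c : ℂ, Vᴴ * V = c • 1)
    (h : ∀ a o, o ≠ a →
      (P.run o (vecMulVec ((U ⊗ₖ V) *ᵥ ψ a) (star ((U ⊗ₖ V) *ᵥ ψ a)))).trace = 0) :
    (Uᴴ * U) ⊗ₖ (Vᴴ * V) = 0 := by
  induction P with
  | halt x =>
    -- A state `ψ a` with `a ≠ x` must have norm zero here, but `U ⊗ V` only rescales norms, so its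
    -- scalar vanishes.
    obtain ⟨a, ha⟩ := exists_ne x
    have := h a x ha.symm
    obtain ⟨c, hc⟩ := hU
    obtain ⟨d, hd⟩ := hV
    simp only [run, if_true] at this
    rw [trace_vecMulVec_star, star_mulVec_dotProduct_mulVec, conjTranspose_kronecker,
      ← mul_kronecker_mul, hc, hd, smul_kronecker, kronecker_smul, one_kronecker_one, smul_mulVec,
      smul_mulVec, one_mulVec, dotProduct_smul, dotProduct_smul, smul_eq_mul, smul_eq_mul] at this
    rw [hc, hd, smul_kronecker, kronecker_smul]
    rcases mul_eq_zero.1 this with h | h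
    · simp [h]
    rcases mul_eq_zero.1 h with h | h
    · simp [h]
    · exact absurd (dotProduct_star_self_eq_zero.1 h) (hψ a)
  | alice d K hK next ih =>
    obtain ⟨e, he⟩ := hV
    -- For `e ≠ 0` the factor `Vᴴ V = e • 1` can be cancelled below, which leaves a condition on the
    -- other party's effect alone.
    by_cases he0 : e = 0
    · simp [he, he0]
    have hbranch : ∀ i a o, o ≠ a → ((next i).run o (vecMulVec (((K i * U) ⊗ₖ V) *ᵥ ψ a)
        (star (((K i * U) ⊗ₖ V) *ᵥ ψ a)))).trace = 0 := fun i a o ho => by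
      have := trace_run_eq_zero_of_sum o next _ (fun i =>
        (posSemidef_vecMulVec_self_star _).mul_mul_conjTranspose_same _) (h a o ho) i
      rwa [mul_vecMulVec_star_mul_conjTranspose, mulVec_mulVec, ← mul_kronecker_mul, Matrix.one_mul] at this
    have hsum : Uᴴ * U = ∑ i, (K i * U)ᴴ * (K i * U) := by
      simp only [conjTranspose_mul, Matrix.mul_assoc]
      rw [← Matrix.mul_sum]
      simp only [← Matrix.mul_assoc (K _)ᴴ]
      rw [← Matrix.sum_mul, hK, Matrix.one_mul]
    have hzero : ∀ i, ((K i * U)ᴴ * (K i * U)) ⊗ₖ (Vᴴ * V) = 0 := fun i => by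
      -- The branch states are still orthogonal, so `hA` makes the accumulated effect scalar: the
      -- invariant passes to `K i * U`.
      refine ih i (K i * U) V (hA _ (isHermitian_conjTranspose_mul_self _) fun a b hab => ?_)
        ⟨e, he⟩ (hbranch i)
      have := dotProduct_eq_zero_of_trace_run hab (next i) _ _ (hbranch i a) (hbranch i b)
      rw [star_mulVec_dotProduct_mulVec, conjTranspose_kronecker, ← mul_kronecker_mul, he,
        kronecker_smul, smul_mulVec, dotProduct_smul, smul_eq_mul] at this
      exact (mul_eq_zero.1 this).resolve_left he0
    rw [hsum, sum_kronecker]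
    exact Finset.sum_eq_zero fun i _ => hzero i
  | bob d K hK next ih =>
    obtain ⟨e, he⟩ := hU
    by_cases he0 : e = 0
    · simp [he, he0]
    have hbranch : ∀ i a o, o ≠ a → ((next i).run o (vecMulVec ((U ⊗ₖ (K i * V)) *ᵥ ψ a)
        (star ((U ⊗ₖ (K i * V)) *ᵥ ψ a)))).trace = 0 := fun i a o ho => by
      have := trace_run_eq_zero_of_sum o next _ (fun i =>
        (posSemidef_vecMulVec_self_star _).mul_mul_conjTranspose_same _) (h a o ho) i
      rwa [mul_vecMulVec_star_mul_conjTranspose, mulVec_mulVec, ← mul_kronecker_mul, Matrix.one_mul] at this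
    have hsum : Vᴴ * V = ∑ i, (K i * V)ᴴ * (K i * V) := by
      simp only [conjTranspose_mul, Matrix.mul_assoc]
      rw [← Matrix.mul_sum]
      simp only [← Matrix.mul_assoc (K _)ᴴ]
      rw [← Matrix.sum_mul, hK, Matrix.one_mul]
    have hzero : ∀ i, (Uᴴ * U) ⊗ₖ ((K i * V)ᴴ * (K i * V)) = 0 := fun i => by
      refine ih i U (K i * V) ⟨e, he⟩
        (hB _ (isHermitian_conjTranspose_mul_self _) fun a b hab => ?_) (hbranch i)
      have := dotProduct_eq_zero_of_trace_run hab (next i) _ _ (hbranch i a) (hbranch i b)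
      rw [star_mulVec_dotProduct_mulVec, conjTranspose_kronecker, ← mul_kronecker_mul, he,
        smul_kronecker, smul_mulVec, dotProduct_smul, smul_eq_mul] at this
      exact (mul_eq_zero.1 this).resolve_left he0
    rw [hsum, kronecker_sum]
    exact Finset.sum_eq_zero fun i _ => hzero i

/-- Run `P`, then run `Q` on its final state. -/
def andThen {m₁ n₁ m n : ℕ} {O' : Type} :
    Protocol m₁ n₁ O' m n → Protocol m' n' O m₁ n₁ → Protocol m' n' O m n
  | .halt _, Q => Q
  | .alice d K hK next, Q => .alice d K hK fun i => (next i).andThen Q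
  | .bob d K hK next, Q => .bob d K hK fun i => (next i).andThen Q

lemma run_andThen {m₁ n₁ m n : ℕ} (P : Protocol m₁ n₁ Unit m n)
    (Q : Protocol m' n' O m₁ n₁) (o : O) (ρ : Op m n) :
    (P.andThen Q).run o ρ = Q.run o (P.run () ρ) := by
  induction P with
  | halt x => simp [andThen, run]
  | alice d K hK next ih => simp only [andThen, run, ih, run_sum]
  | bob d K hK next ih => simp only [andThen, run, ih, run_sum]

end Protocol

/-- Pure states that stay orthogonal only under trivial local measurements are not perfectly
distinguishable by LOCC. -/
theorem not_loccDistinguishable_of_scalar {m n r : ℕ} [Nontrivial (Fin r)] (ψ : Fin r → Space m n)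
    (hψ : ∀ a, ψ a ≠ 0)
    (hA : ∀ M : Matrix (Fin m) (Fin m) ℂ, M.IsHermitian →
      (∀ a b, a ≠ b →
        star (ψ a).ofLp ⬝ᵥ ((M ⊗ₖ (1 : Matrix (Fin n) (Fin n) ℂ)) *ᵥ (ψ b).ofLp) = 0) →
      ∃ c : ℂ, M = c • 1)
    (hB : ∀ M : Matrix (Fin n) (Fin n) ℂ, M.IsHermitian →
      (∀ a b, a ≠ b →
        star (ψ a).ofLp ⬝ᵥ (((1 : Matrix (Fin m) (Fin m) ℂ) ⊗ₖ M) *ᵥ (ψ b).ofLp) = 0) →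
      ∃ c : ℂ, M = c • 1) :
    ¬ LOCCDistinguishable fun k => pureOp (ψ k) := by
  rintro ⟨m', n', P, hP⟩
  have hne : ∀ a, (ψ a).ofLp ≠ 0 := fun a h => hψ a (by ext x; simp [h])
  have h := P.kronecker_eq_zero_of_trace_run (fun a => (ψ a).ofLp) hne hA hB 1 1 ⟨1, by simp⟩
    ⟨1, by simp⟩ fun a o ho => by
      rw [one_kronecker_one, one_mulVec]
      have := hP o a
      rwa [if_neg ho] at this
  obtain ⟨a, -⟩ := exists_pair_ne (Fin r)
  apply hne a
  rw [← one_mulVec (ψ a).ofLp]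
  simp only [conjTranspose_one, mul_one, one_kronecker_one] at h
  rw [h, zero_mulVec]

/-- An LOCC operation cannot map states that are not LOCC distinguishable to states that are. -/
theorem IsLOCC.loccDistinguishable {m n r : ℕ} {F : Op m n →ₗ[ℂ] Op m n} (hF : IsLOCC F)
    {ρ : Fin r → Op m n} (h : LOCCDistinguishable fun k => F (ρ k)) : LOCCDistinguishable ρ := by
  obtain ⟨P, hP⟩ := hF
  obtain ⟨m', n', Q, hQ⟩ := h
  refine ⟨m', n', P.andThen Q, fun k j => ?_⟩
  rw [Protocol.run_andThen, ← hP, hQ]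

/-! ### Separable operators as sums over product vectors -/

lemma trace_pureOp {m n : ℕ} (ψ : Space m n) : (pureOp ψ).trace = ((‖ψ‖ ^ 2 : ℝ) : ℂ) := by
  rw [EuclideanSpace.norm_sq_eq, Matrix.trace]
  push_cast
  refine Finset.sum_congr rfl fun p _ => ?_
  simp [pureOp, Complex.mul_conj, Complex.normSq_eq_norm_sq]

lemma pureOp_posSemidef {m n : ℕ} (ψ : Space m n) : (pureOp ψ).PosSemidef :=
  posSemidef_vecMulVec_self_star _

lemma pureOp_smul {m n : ℕ} (c : ℂ) (ψ : Space m n) :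
    pureOp (c • ψ) = ((‖c‖ ^ 2 : ℝ) : ℂ) • pureOp ψ := by
  ext p q
  have : c * star c = ((‖c‖ ^ 2 : ℝ) : ℂ) := by
    simp [Complex.mul_conj, Complex.normSq_eq_norm_sq]
  simp only [pureOp, of_apply, PiLp.smul_apply, smul_eq_mul, star_mul', Matrix.smul_apply, ← this]
  ring

lemma IsProduct.smul {m n : ℕ} {ψ : Space m n} (h : IsProduct ψ) (c : ℂ) : IsProduct (c • ψ) := by
  obtain ⟨a, b, h⟩ := h
  exact ⟨c • a, b, fun i j => by simp [h, mul_assoc]⟩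

/-- A nonempty sum of operators `|v⟩⟨v|` with nonzero product vectors `v` is separable. -/
lemma isSeparableOp_sum_pureOp {m n N : ℕ} [NeZero N] (v : Fin N → Space m n)
    (hv : ∀ k, v k ≠ 0) (hp : ∀ k, IsProduct (v k)) : IsSeparableOp (∑ k, pureOp (v k)) := by
  have htr : (∑ k, pureOp (v k)).trace = ((∑ k, ‖v k‖ ^ 2 : ℝ) : ℂ) := by
    rw [trace_sum]
    push_cast
    exact Finset.sum_congr rfl fun k _ => by rw [trace_pureOp]; push_cast; rfl
  have hnorm : ∀ k, 0 < ‖v k‖ := fun k => norm_pos_iff.2 (hv k)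
  have hpos : 0 < ∑ k, ‖v k‖ ^ 2 :=
    Finset.sum_pos (fun k _ => pow_pos (hnorm k) 2) Finset.univ_nonempty
  refine ⟨fun h => ?_, posSemidef_sum _ fun k _ => pureOp_posSemidef _, N,
    fun k => ‖v k‖ ^ 2 / ∑ k, ‖v k‖ ^ 2, fun k => ((‖v k‖⁻¹ : ℝ) : ℂ) • v k,
    fun k => div_pos (pow_pos (hnorm k) 2) hpos, ?_, fun k => ⟨?_, (hp k).smul _⟩, ?_⟩
  · rw [h, trace_zero] at htr
    exact hpos.ne (by exact_mod_cast htr)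
  · rw [← Finset.sum_div, div_self hpos.ne']
  · rw [norm_smul, Complex.norm_real, norm_inv, norm_norm, inv_mul_cancel₀ (hnorm k).ne']
  · rw [htr, Finset.smul_sum]
    refine Finset.sum_congr rfl fun k _ => ?_
    rw [pureOp_smul, smul_smul, ← Complex.ofReal_inv, ← Complex.ofReal_mul, Complex.norm_real,
      norm_inv, norm_norm]
    congr 2
    have := (hnorm k).ne'
    field_simp

/-- The weights are absorbed into the vectors as square roots; this is the form from which Kraus
operators are read off. -/
lemma IsSeparableState.exists_sum_pureOp {m n : ℕ} {ρ : Op m n} (h : IsSeparableState ρ) :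
    ∃ (N : ℕ) (v : Fin N → Space m n), (∀ k, IsProduct (v k)) ∧ ρ = ∑ k, pureOp (v k) := by
  obtain ⟨N, p, ψ, hp, -, hψ, rfl⟩ := h
  refine ⟨N, fun k => ((√(p k) : ℝ) : ℂ) • ψ k, fun k => (hψ k).2.smul _,
    Finset.sum_congr rfl fun k _ => ?_⟩
  rw [pureOp_smul, Complex.norm_real, Real.norm_eq_abs, sq_abs, Real.sq_sqrt (hp k).le]

lemma IsSeparableState.trace_eq_one {m n : ℕ} {ρ : Op m n} (h : IsSeparableState ρ) :
    ρ.trace = 1 := by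
  obtain ⟨N, p, ψ, -, hp, hψ, rfl⟩ := h
  simp only [trace_sum, trace_smul, trace_pureOp, (hψ _).1]
  simp [← Complex.ofReal_sum, hp]

lemma IsSeparableOp.exists_sum_pureOp {m n : ℕ} {E : Op m n} (h : IsSeparableOp E) :
    ∃ (N : ℕ) (v : Fin N → Space m n), (∀ k, IsProduct (v k)) ∧ E = ∑ k, pureOp (v k) := by
  obtain ⟨h0, hE, hs⟩ := h
  obtain ⟨N, v, hv, hEv⟩ := hs.exists_sum_pureOp
  have htr : E.trace ≠ 0 := fun h => h0 (hE.trace_eq_zero_iff.1 h)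
  obtain ⟨t, ht, htE⟩ : ∃ t : ℝ, 0 ≤ t ∧ (t : ℂ) = E.trace :=
    ⟨E.trace.re, (Complex.nonneg_iff.1 hE.trace_nonneg).1,
      Complex.ext rfl (Complex.nonneg_iff.1 hE.trace_nonneg).2⟩
  refine ⟨N, fun k => ((√t : ℝ) : ℂ) • v k, fun k => (hv k).smul _, ?_⟩
  simp only [pureOp_smul, Complex.norm_real, Real.norm_eq_abs, sq_abs, Real.sq_sqrt ht]
  rw [← Finset.smul_sum, ← hEv, htE, smul_smul, mul_inv_cancel₀ htr, one_smul]

/-! ### Measure-and-prepare operations -/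

/-- The map that measures `M` and prepares `σ k` on the outcome `k`. -/
noncomputable def measurePrepare {m n r : ℕ} (M σ : Fin r → Op m n) : Op m n →ₗ[ℂ] Op m n :=
  ∑ k, (traceLinearMap (Fin m × Fin n) ℂ ℂ ∘ₗ LinearMap.mulLeft ℂ (M k)).smulRight (σ k)

lemma measurePrepare_apply {m n r : ℕ} (M σ : Fin r → Op m n) (ρ : Op m n) :
    measurePrepare M σ ρ = ∑ k, (M k * ρ).trace • σ k := by
  simp [measurePrepare, LinearMap.sum_apply]

lemma isSeparableOperation_of_fintype {m n : ℕ} {F : Op m n →ₗ[ℂ] Op m n} {ι : Type*} [Fintype ι]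
    (A : ι → Matrix (Fin m) (Fin m) ℂ) (B : ι → Matrix (Fin n) (Fin n) ℂ)
    (h1 : ∑ k, (A k ⊗ₖ B k)ᴴ * (A k ⊗ₖ B k) = 1)
    (hF : ∀ ρ, F ρ = ∑ k, (A k ⊗ₖ B k) * ρ * (A k ⊗ₖ B k)ᴴ) : IsSeparableOperation F := by
  let e := (Fintype.equivFin ι).symm
  refine ⟨Fintype.card ι, A ∘ e, B ∘ e, ?_, fun ρ => ?_⟩
  · rw [← h1]
    exact e.sum_comp fun k => (A k ⊗ₖ B k)ᴴ * (A k ⊗ₖ B k)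
  · rw [hF]
    exact (e.sum_comp fun k => (A k ⊗ₖ B k) * ρ * (A k ⊗ₖ B k)ᴴ).symm

/-- For `v = a ⊗ b` and `w = c ⊗ d`, `|w⟩⟨v|` factors as `|c⟩⟨a| ⊗ |d⟩⟨b|`, an admissible Kraus
operator. -/
lemma exists_kronecker_eq_vecMulVec {m n : ℕ} {v w : Space m n} (hv : IsProduct v)
    (hw : IsProduct w) : ∃ (A : Matrix (Fin m) (Fin m) ℂ) (B : Matrix (Fin n) (Fin n) ℂ),
      A ⊗ₖ B = vecMulVec w.ofLp (star v.ofLp) := by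
  obtain ⟨a, b, hv⟩ := hv
  obtain ⟨c, d, hw⟩ := hw
  refine ⟨vecMulVec c.ofLp (star a.ofLp), vecMulVec d.ofLp (star b.ofLp), ?_⟩
  ext ⟨i, j⟩ ⟨k, l⟩
  simp only [kroneckerMap_apply, vecMulVec_apply, Pi.star_apply, hv, hw, star_mul']
  ring

lemma trace_pureOp_mul {m n : ℕ} (v : Space m n) (ρ : Op m n) :
    (pureOp v * ρ).trace = star v.ofLp ⬝ᵥ (ρ *ᵥ v.ofLp) := by
  rw [pureOp_eq_vecMulVec, vecMulVec_mul, trace_vecMulVec, dotProduct_comm, ← dotProduct_mulVec]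

/-- Measuring a separable POVM and preparing separable states is a separable operation. -/
theorem isSeparableOperation_measurePrepare {m n r : ℕ} {M σ : Fin r → Op m n}
    (hM : IsSeparablePOVM M) (hσ : ∀ k, IsSeparableState (σ k)) :
    IsSeparableOperation (measurePrepare M σ) := by
  choose N v hv hMv using fun k => (hM.1 k).exists_sum_pureOp
  choose N' w hw hσw using fun k => (hσ k).exists_sum_pureOp
  -- The Kraus operators are all `|w⟩⟨v|` with `v` from the decomposition of `M k` and `w` from that
  -- of `σ k`. They are complete because `σ k` has trace one.
  choose A B hAB using fun x : (k : Fin r) × (Fin (N k) × Fin (N' k)) =>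
    exists_kronecker_eq_vecMulVec (hv x.1 x.2.1) (hw x.1 x.2.2)
  refine isSeparableOperation_of_fintype A B ?_ fun ρ => ?_
  · rw [← hM.2, Fintype.sum_sigma]
    refine Finset.sum_congr rfl fun k _ => ?_
    have htr : ∑ l, star (w k l).ofLp ⬝ᵥ (w k l).ofLp = 1 := by
      rw [← (hσ k).trace_eq_one, hσw k, trace_sum]
      exact Finset.sum_congr rfl fun l _ => (trace_vecMulVec_star _).symm
    have : ∀ x : Fin (N k) × Fin (N' k), (A ⟨k, x⟩ ⊗ₖ B ⟨k, x⟩)ᴴ * (A ⟨k, x⟩ ⊗ₖ B ⟨k, x⟩) =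
        (star (w k x.2).ofLp ⬝ᵥ (w k x.2).ofLp) • pureOp (v k x.1) := fun x => by
      rw [hAB, conjTranspose_vecMulVec, star_star, vecMulVec_mul_vecMulVec, vecMulVec_smul]
      rfl
    simp only [this, Fintype.sum_prod_type]
    rw [hMv k]
    refine Finset.sum_congr rfl fun l _ => ?_
    rw [← Finset.sum_smul, htr, one_smul]
  · rw [measurePrepare_apply, Fintype.sum_sigma]
    refine Finset.sum_congr rfl fun k _ => ?_
    have : ∀ x : Fin (N k) × Fin (N' k), (A ⟨k, x⟩ ⊗ₖ B ⟨k, x⟩) * ρ * (A ⟨k, x⟩ ⊗ₖ B ⟨k, x⟩)ᴴ =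
        (star (v k x.1).ofLp ⬝ᵥ (ρ *ᵥ (v k x.1).ofLp)) • pureOp (w k x.2) := fun x => by
      rw [hAB, conjTranspose_vecMulVec, star_star, vecMulVec_mul, vecMulVec_mul_vecMulVec,
        vecMulVec_smul, ← dotProduct_mulVec]
      rfl
    simp only [this, Fintype.sum_prod_type, ← trace_pureOp_mul]
    rw [hσw k, hMv k, Matrix.sum_mul, trace_sum, Finset.sum_smul]
    simp only [Finset.smul_sum]

/-- Measuring a POVM that distinguishes the states `ρ k` and preparing `σ k` maps `ρ k` to `σ k`. -/
lemma measurePrepare_apply_of_distinguish {m n r : ℕ} {M ρ : Fin r → Op m n}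
    (h : ∀ k j, (M k * ρ j).trace = if k = j then 1 else 0) (σ : Fin r → Op m n) (j : Fin r) :
    measurePrepare M σ (ρ j) = σ j := by
  simp [measurePrepare_apply, h]

/-- Separable operations map any separably distinguishable states that are not LOCC distinguishable
to any LOCC distinguishable separable states, and no LOCC operation does. -/
theorem exists_separable_not_locc {m n r : ℕ} {ρ σ : Fin r → Op m n}
    (hρ : SepDistinguishable ρ) (hρ' : ¬ LOCCDistinguishable ρ)
    (hσ : ∀ k, IsSeparableState (σ k)) (hσ' : LOCCDistinguishable σ) :
    ∃ F : Op m n →ₗ[ℂ] Op m n, IsSeparableOperation F ∧ (∀ k, F (ρ k) = σ k) ∧ ¬ IsLOCC F := by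
  obtain ⟨M, hM, hMρ⟩ := hρ
  have hF := measurePrepare_apply_of_distinguish hMρ σ
  exact ⟨measurePrepare M σ, isSeparableOperation_measurePrepare hM hσ, hF,
    fun h => hρ' (h.loccDistinguishable (by simpa only [hF] using hσ'))⟩

/-! ### The determinant criterion for two qubits -/

/-- The determinant of the coefficient matrix of a two-qubit vector. -/
def coeffDet (ψ : Space 2 2) : ℂ := ψ (0, 0) * ψ (1, 1) - ψ (0, 1) * ψ (1, 0)

/-- The polarization of `coeffDet`. -/
def coeffDetCross (ψ φ : Space 2 2) : ℂ :=
  ψ (0, 0) * φ (1, 1) + φ (0, 0) * ψ (1, 1) - ψ (0, 1) * φ (1, 0) - φ (0, 1) * ψ (1, 0)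

/-- A 2×2 matrix has rank at most one iff it is singular. The factors come from a nonzero entry of
the first row, if there is one. -/
lemma isProduct_iff_coeffDet (ψ : Space 2 2) : IsProduct ψ ↔ coeffDet ψ = 0 := by
  constructor
  · rintro ⟨a, b, h⟩
    simp only [coeffDet, h]
    ring
  intro h
  rw [coeffDet, sub_eq_zero] at h
  by_cases h0 : ψ (0, 0) = 0 ∧ ψ (0, 1) = 0
  · refine ⟨!₂[0, 1], !₂[ψ (1, 0), ψ (1, 1)], fun i j => ?_⟩
    fin_cases i <;> fin_cases j <;> simp [h0.1, h0.2]
  by_cases h00 : ψ (0, 0) = 0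
  · have h01 : ψ (0, 1) ≠ 0 := fun h => h0 ⟨h00, h⟩
    have h10 : ψ (1, 0) = 0 := by simpa [h00, h01] using h
    refine ⟨!₂[1, ψ (1, 1) / ψ (0, 1)], !₂[0, ψ (0, 1)], fun i j => ?_⟩
    fin_cases i <;> fin_cases j <;> simp [h00, h10, h01]
  · refine ⟨!₂[1, ψ (1, 0) / ψ (0, 0)], !₂[ψ (0, 0), ψ (0, 1)], fun i j => ?_⟩
    fin_cases i <;> fin_cases j <;> simp [h00]
    field_simp
    linear_combination h

lemma coeffDet_add_smul (ψ φ : Space 2 2) (t : ℂ) :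
    coeffDet (ψ + t • φ) = coeffDet ψ + t * coeffDetCross ψ φ + t ^ 2 * coeffDet φ := by
  simp only [coeffDet, coeffDetCross, PiLp.add_apply, PiLp.smul_apply, smul_eq_mul]
  ring

/-- A two-qubit vector with nonpositive determinant becomes separable by mixing in a multiple of a
vector with positive determinant. -/
lemma isSeparableOp_pureOp_add {ψ φ : Space 2 2} {a b c : ℝ} (hψ : ψ ≠ 0)
    (hda : coeffDet ψ = a) (hdb : coeffDetCross ψ φ = b) (hdc : coeffDet φ = c)
    (ha : a ≤ 0) (hc : 0 < c) :
    IsSeparableOp (pureOp ψ + ((-a / c : ℝ) : ℂ) • pureOp φ) := by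
  rcases ha.eq_or_lt with rfl | ha
  · have := isSeparableOp_sum_pureOp (fun _ : Fin 1 => ψ) (fun _ => hψ)
      (fun _ => (isProduct_iff_coeffDet ψ).2 (by simpa using hda))
    simpa using this
  -- Since `a c < 0`, the quadratic `a + b t + c t²` has two real roots of opposite sign,
  -- equivalently `|b| < D`.
  have hD : b ^ 2 < b ^ 2 - 4 * a * c := by nlinarith
  set D := √(b ^ 2 - 4 * a * c) with hDdef
  have hD2 : D ^ 2 = b ^ 2 - 4 * a * c := Real.sq_sqrt ((sq_nonneg b).trans hD.le)
  have hbD : |b| < D := by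
    rw [← Real.sqrt_sq_eq_abs]
    exact Real.sqrt_lt_sqrt (sq_nonneg b) hD
  obtain ⟨hb1, hb2⟩ := abs_lt.1 hbD
  have hDpos : 0 < D := by linarith
  have hroot : ∀ t : ℝ, a + t * b + t ^ 2 * c = 0 →
      ψ + (t : ℂ) • φ ≠ 0 ∧ IsProduct (ψ + (t : ℂ) • φ) := fun t ht => by
    constructor
    -- If `ψ = -t φ`, then `a = t² c ≥ 0`, contrary to `a < 0`.
    · intro h
      have h' : ψ = (-t : ℂ) • φ := by rw [neg_smul]; exact eq_neg_of_add_eq_zero_left h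
      have : ((a : ℝ) : ℂ) = ((t ^ 2 * c : ℝ) : ℂ) := by
        rw [← hda, h', Complex.ofReal_mul, ← hdc]
        simp only [coeffDet, PiLp.smul_apply, smul_eq_mul]
        push_cast
        ring
      have : a = t ^ 2 * c := by exact_mod_cast this
      nlinarith [mul_nonneg (sq_nonneg t) hc.le]
    · rw [isProduct_iff_coeffDet, coeffDet_add_smul, hda, hdb, hdc]
      exact_mod_cast ht
  have h1 := hroot ((-b - D) / (2 * c)) (by field_simp; linear_combination hD2)
  have h2 := hroot ((-b + D) / (2 * c)) (by field_simp; linear_combination hD2)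
  have hp1 : 0 < (D - b) / (2 * D) := div_pos (by linarith) (by linarith)
  have hp2 : 0 < (D + b) / (2 * D) := div_pos (by linarith) (by linarith)
  -- The weights `(D ∓ b) / (2 D)` give the roots mean zero, which cancels the cross terms; their
  -- second moment is then minus the product of the roots, `-a / c`.
  have key := isSeparableOp_sum_pureOp
    ![((√((D - b) / (2 * D)) : ℝ) : ℂ) • (ψ + (((-b - D) / (2 * c) : ℝ) : ℂ) • φ),
      ((√((D + b) / (2 * D)) : ℝ) : ℂ) • (ψ + (((-b + D) / (2 * c) : ℝ) : ℂ) • φ)]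
    (by
      intro k
      fin_cases k
      · exact smul_ne_zero (by exact_mod_cast (Real.sqrt_pos.2 hp1).ne') h1.1
      · exact smul_ne_zero (by exact_mod_cast (Real.sqrt_pos.2 hp2).ne') h2.1)
    (by
      intro k
      fin_cases k
      · exact h1.2.smul _
      · exact h2.2.smul _)
  convert key using 1
  rw [Fin.sum_univ_two]
  simp only [cons_val_zero, cons_val_one, pureOp_smul, Complex.norm_real, Real.norm_eq_abs, sq_abs,
    Real.sq_sqrt hp1.le, Real.sq_sqrt hp2.le]
  have hDC : (D : ℂ) ≠ 0 := by exact_mod_cast hDpos.ne'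
  have hcC : (c : ℂ) ≠ 0 := by exact_mod_cast hc.ne'
  have hD2C : (D : ℂ) ^ 2 = b ^ 2 - 4 * a * c := by exact_mod_cast hD2
  ext p q
  simp only [pureOp, Matrix.add_apply, Matrix.smul_apply, of_apply, PiLp.add_apply, PiLp.smul_apply,
    smul_eq_mul, star_add, star_mul', Complex.star_def, Complex.conj_ofReal]
  push_cast
  field_simp
  linear_combination (-(2 : ℂ) * D * φ p * (starRingEnd ℂ) (φ q)) * hD2C

/-! ### The states in coordinates -/

section Coordinates

variable (θ : ℝ)

lemma psi_apply (i j : Fin 2) : psi θ (i, j) =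
    !![0, ((Real.cos θ : ℝ) : ℂ); ((Real.sin θ : ℝ) : ℂ), 0] i j := by
  fin_cases i <;> fin_cases j <;> simp [psi, ket]

lemma phi_apply (i j : Fin 2) : phi θ (i, j) =
    !![((Real.cos θ : ℝ) : ℂ), 0; 0, ((Real.sin θ : ℝ) : ℂ)] i j := by
  fin_cases i <;> fin_cases j <;> simp [phi, ket]

end Coordinates

lemma inner_space_two (ψ φ : Space 2 2) : inner ℂ ψ φ =
    star (ψ (0, 0)) * φ (0, 0) + star (ψ (0, 1)) * φ (0, 1) + star (ψ (1, 0)) * φ (1, 0) +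
      star (ψ (1, 1)) * φ (1, 1) := by
  simp [PiLp.inner_apply, Fintype.sum_prod_type, Fin.sum_univ_two]
  ring

section Basis

variable (α β γ : ℝ)

lemma basisState_zero_apply (i j : Fin 2) : basisState α β γ 0 (i, j) =
    ((!![0, Real.cos α; Real.sin α, 0] i j : ℝ) : ℂ) := by
  fin_cases i <;> fin_cases j <;> simp [basisState, psi_apply]

lemma basisState_one_apply (i j : Fin 2) : basisState α β γ 1 (i, j) =
    ((!![Real.sin γ * Real.sin β, Real.cos γ * Real.sin α;
      -(Real.cos γ * Real.cos α), -(Real.sin γ * Real.cos β)] i j : ℝ) : ℂ) := by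
  fin_cases i <;> fin_cases j <;>
    simp [basisState, psi_apply, phi_apply, Complex.cos_sub_pi_div_two, Complex.sin_sub_pi_div_two]

lemma basisState_two_apply (i j : Fin 2) : basisState α β γ 2 (i, j) =
    ((!![-(Real.cos γ * Real.sin β), Real.sin γ * Real.sin α;
      -(Real.sin γ * Real.cos α), Real.cos γ * Real.cos β] i j : ℝ) : ℂ) := by
  fin_cases i <;> fin_cases j <;>
    simp [basisState, psi_apply, phi_apply, Complex.cos_sub_pi_div_two, Complex.sin_sub_pi_div_two]

lemma coeffDet_phi : coeffDet (phi β) = ((Real.sin (2 * β) / 2 : ℝ) : ℂ) := by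
  rw [Real.sin_two_mul]
  simp [coeffDet, phi_apply]
  ring

lemma coeffDet_basisState (k : Fin 3) : coeffDet (basisState α β γ k) =
    (((![-Real.sin (2 * α),
      Real.cos γ ^ 2 * Real.sin (2 * α) - Real.sin γ ^ 2 * Real.sin (2 * β),
      Real.sin γ ^ 2 * Real.sin (2 * α) - Real.cos γ ^ 2 * Real.sin (2 * β)] : Fin 3 → ℝ) k / 2 : ℝ)
        : ℂ) := by
  simp only [Real.sin_two_mul]
  fin_cases k <;>
    simp [coeffDet, basisState_zero_apply, basisState_one_apply, basisState_two_apply] <;> ring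

/-- Only the reality of these values matters: it makes the quadratic in `t` real. -/
lemma coeffDetCross_basisState_phi (k : Fin 3) : coeffDetCross (basisState α β γ k) (phi β) =
    (((![0, -(Real.sin γ * (Real.cos β ^ 2 - Real.sin β ^ 2)),
      Real.cos γ * (Real.cos β ^ 2 - Real.sin β ^ 2)] : Fin 3 → ℝ) k : ℝ) : ℂ) := by
  fin_cases k <;>
    simp [coeffDetCross, phi_apply, basisState_zero_apply, basisState_one_apply,
      basisState_two_apply] <;> ring

lemma norm_phi : ‖phi β‖ = 1 := by
  have h : (inner ℂ (phi β) (phi β) : ℂ) = 1 := by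
    simp only [inner_space_two, phi_apply]
    simp [-Complex.ofReal_cos, -Complex.ofReal_sin]
    norm_cast
    linear_combination Real.cos_sq_add_sin_sq β
  rw [norm_eq_sqrt_re_inner (𝕜 := ℂ), h]
  simp

lemma inner_phi_basisState (k : Fin 3) : inner ℂ (phi β) (basisState α β γ k) = 0 := by
  fin_cases k <;>
    simp [inner_space_two, phi_apply, basisState_zero_apply, basisState_one_apply,
      basisState_two_apply, -Complex.ofReal_cos, -Complex.ofReal_sin] <;> ring

lemma orthonormal_basisState : Orthonormal ℂ (basisState α β γ) := by
  have ha := Real.cos_sq_add_sin_sq α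
  have hb := Real.cos_sq_add_sin_sq β
  have hc := Real.cos_sq_add_sin_sq γ
  rw [orthonormal_iff_ite]
  intro i j
  rw [inner_space_two]
  fin_cases i <;> fin_cases j <;>
    simp [basisState_zero_apply, basisState_one_apply,
      basisState_two_apply, -Complex.ofReal_cos, -Complex.ofReal_sin] <;> norm_cast <;> grind

lemma span_basisState : Submodule.span ℂ (Set.range (basisState α β γ)) =
    (Submodule.span ℂ {phi β})ᗮ := by
  apply Submodule.eq_of_le_of_finrank_eq
  · rw [Submodule.span_le]
    rintro _ ⟨k, rfl⟩
    rw [SetLike.mem_coe, Submodule.mem_orthogonal_singleton_iff_inner_right]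
    exact inner_phi_basisState α β γ k
  · have : Fact (Module.finrank ℂ (Space 2 2) = 3 + 1) := ⟨by simp⟩
    rw [finrank_span_eq_card (orthonormal_basisState α β γ).linearIndependent,
      Submodule.finrank_orthogonal_span_singleton (n := 3)]
    · simp
    · intro h
      simpa [h] using norm_phi β

lemma sum_pureOp_basisState : ∑ k, pureOp (basisState α β γ k) + pureOp (phi β) = 1 := by
  have ha := Real.cos_sq_add_sin_sq α
  have hb := Real.cos_sq_add_sin_sq β
  have hc := Real.cos_sq_add_sin_sq γ
  ext ⟨i, j⟩ ⟨k, l⟩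
  fin_cases i <;> fin_cases j <;> fin_cases k <;> fin_cases l <;>
    simp [pureOp, Fin.sum_univ_three, basisState_zero_apply, basisState_one_apply,
      basisState_two_apply, phi_apply, -Complex.ofReal_cos, -Complex.ofReal_sin] <;>
    norm_cast <;> grind

end Basis

/-! ### The range of `γ` and the separable POVM -/

section Angles

variable {α β γ : ℝ}

/-- Dividing by `cos² γ > 0` turns the comparison into `a / b ≤ tan² γ`. -/
lemma cos_sq_mul_eq_iff {a b : ℝ} (ha : 0 < a) (hb : 0 < b) (hγ : Real.arctan (√(a / b)) ≤ γ)
    (hγ' : γ < Real.pi / 2) :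
    Real.cos γ ^ 2 * a ≤ Real.sin γ ^ 2 * b ∧
      (Real.cos γ ^ 2 * a = Real.sin γ ^ 2 * b ↔ γ = Real.arctan (√(a / b))) := by
  have h0 : 0 ≤ Real.arctan (√(a / b)) := Real.arctan_nonneg.2 (Real.sqrt_nonneg _)
  have hcos : 0 < Real.cos γ := Real.cos_pos_of_mem_Ioo ⟨by linarith [Real.pi_pos], hγ'⟩
  have harc : Real.arctan (Real.tan γ) = γ := Real.arctan_tan (by linarith [Real.pi_pos]) hγ'
  have htan : √(a / b) ≤ Real.tan γ := by
    rwa [← harc, Real.arctan_le_arctan_iff] at hγ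
  have hsq : √(a / b) ^ 2 = a / b := Real.sq_sqrt (div_pos ha hb).le
  have hsin : Real.sin γ = Real.tan γ * Real.cos γ := (Real.tan_mul_cos hcos.ne').symm
  have htan2 : a / b ≤ Real.tan γ ^ 2 := by
    rw [← hsq]
    exact pow_le_pow_left₀ (Real.sqrt_nonneg _) htan 2
  rw [hsin]
  refine ⟨?_, fun h => ?_, fun h => ?_⟩
  · rw [div_le_iff₀ hb] at htan2
    nlinarith [mul_le_mul_of_nonneg_left htan2 (sq_nonneg (Real.cos γ))]
  · have : Real.tan γ ^ 2 = a / b := by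
      rw [eq_div_iff hb.ne']
      apply mul_left_cancel₀ (pow_ne_zero 2 hcos.ne')
      linear_combination -h
    rw [← this, Real.sqrt_sq ((Real.sqrt_nonneg _).trans htan), harc]
  · have : Real.tan γ ^ 2 = a / b := by rw [h, Real.tan_arctan, hsq]
    rw [mul_pow, this]
    field_simp

/-- The range of `γ` in terms of the determinants of the second and third state. -/
lemma coeffDet_signs (hα : 0 < α) (hαβ : α ≤ β) (hβ : β ≤ Real.pi / 4)
    (hγ : gammaMin α β ≤ γ) (hγ' : γ ≤ gammaMax α β) :
    0 < Real.sin (2 * α) ∧ 0 < Real.sin (2 * β) ∧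
    (Real.cos γ ^ 2 * Real.sin (2 * α) ≤ Real.sin γ ^ 2 * Real.sin (2 * β) ∧
      (Real.cos γ ^ 2 * Real.sin (2 * α) = Real.sin γ ^ 2 * Real.sin (2 * β) ↔
        γ = gammaMin α β)) ∧
    (Real.sin γ ^ 2 * Real.sin (2 * α) ≤ Real.cos γ ^ 2 * Real.sin (2 * β) ∧
      (Real.sin γ ^ 2 * Real.sin (2 * α) = Real.cos γ ^ 2 * Real.sin (2 * β) ↔
        γ = gammaMax α β)) := by
  have hpi := Real.pi_pos
  have ha : 0 < Real.sin (2 * α) := Real.sin_pos_of_pos_of_lt_pi (by linarith) (by linarith)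
  have hb : 0 < Real.sin (2 * β) := Real.sin_pos_of_pos_of_lt_pi (by linarith) (by linarith)
  have hmin : 0 < gammaMin α β := Real.arctan_pos.2 (Real.sqrt_pos.2 (div_pos ha hb))
  -- The endpoints are complementary angles, so the claim about the third state is the one about the
  -- second at `π / 2 - γ`.
  have hmax : gammaMax α β = Real.pi / 2 - gammaMin α β := by
    rw [gammaMin, gammaMax, ← Real.arctan_inv_of_pos (Real.sqrt_pos.2 (div_pos ha hb)),
      ← Real.sqrt_inv, inv_div]
  refine ⟨ha, hb, cos_sq_mul_eq_iff ha hb hγ (by linarith), ?_⟩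
  have key := cos_sq_mul_eq_iff (γ := Real.pi / 2 - γ) ha hb
    (show gammaMin α β ≤ _ by linarith) (by linarith)
  rw [Real.cos_pi_div_two_sub, Real.sin_pi_div_two_sub] at key
  refine ⟨key.1, key.2.trans ?_⟩
  rw [hmax]
  change _ = gammaMin α β ↔ _
  constructor <;> intro h <;> linarith

lemma gammaMin_le_gammaMax (hα : 0 < α) (hαβ : α ≤ β) (hβ : β ≤ Real.pi / 4) :
    gammaMin α β ≤ gammaMax α β := by
  have hpi := Real.pi_pos
  have ha : 0 < Real.sin (2 * α) := Real.sin_pos_of_pos_of_lt_pi (by linarith) (by linarith)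
  have hab : Real.sin (2 * α) ≤ Real.sin (2 * β) :=
    Real.sin_le_sin_of_le_of_le_pi_div_two (by linarith) (by linarith) (by linarith)
  refine Real.arctan_mono (Real.sqrt_le_sqrt ?_)
  exact ((div_le_one (ha.trans_le hab)).2 hab).trans ((one_le_div ha).2 hab)

/-- The three states are distinguished by the operators `|Ψₖ⟩⟨Ψₖ| + λₖ |Φ(β)⟩⟨Φ(β)|`, where `λₖ` is
minus the ratio of the determinants of `Ψₖ` and `Φ(β)`. -/
lemma sepDistinguishable_basisState (hα : 0 < α) (hαβ : α ≤ β) (hβ : β ≤ Real.pi / 4)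
    (hγ : gammaMin α β ≤ γ) (hγ' : γ ≤ gammaMax α β) :
    SepDistinguishable fun k => pureOp (basisState α β γ k) := by
  obtain ⟨ha, hb, ⟨h1, -⟩, h2, -⟩ := coeffDet_signs hα hαβ hβ hγ hγ'
  have horth := orthonormal_basisState α β γ
  refine ⟨_, ⟨fun k => isSeparableOp_pureOp_add (horth.ne_zero k) (coeffDet_basisState α β γ k)
    (coeffDetCross_basisState_phi α β γ k) (coeffDet_phi β) ?_ (by linarith), ?_⟩, fun k j => ?_⟩
  · fin_cases k <;> simp <;> linarith
  · rw [Finset.sum_add_distrib, ← Finset.sum_smul, ← sum_pureOp_basisState α β γ,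
      ← Complex.ofReal_sum]
    congr 1
    -- What remains is `∑ λₖ = 1`.
    convert one_smul ℂ _
    rw [Fin.sum_univ_three]
    norm_cast
    simp only [cons_val_zero, cons_val_one, cons_val]
    field_simp
    linear_combination (Real.sin (2 * β) - Real.sin (2 * α)) * Real.cos_sq_add_sin_sq γ
  · have htr : ∀ ψ φ : Space 2 2, (pureOp ψ * pureOp φ).trace = inner ℂ φ ψ * inner ℂ ψ φ :=
      fun ψ φ => by
        rw [trace_pureOp_mul, pureOp_eq_vecMulVec, vecMulVec_mulVec]
        simp [EuclideanSpace.inner_eq_star_dotProduct, dotProduct_comm]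
    rw [Matrix.add_mul, Matrix.smul_mul, trace_add, trace_smul, htr, htr, inner_phi_basisState,
      mul_zero, smul_zero, add_zero, orthonormal_iff_ite.1 horth, orthonormal_iff_ite.1 horth]
    by_cases h : k = j
    · simp [h]
    · simp [h]

end Angles

/-! ### Local effects that preserve orthogonality are scalar -/

lemma eq_smul_one_of_entries {M : Matrix (Fin 2) (Fin 2) ℂ} (hd : M 0 0 = M 1 1) (h01 : M 0 1 = 0)
    (hM : M.IsHermitian) : ∃ c : ℂ, M = c • 1 := by
  have h10 : M 1 0 = 0 := by rw [← hM.apply 1 0, h01, star_zero]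
  refine ⟨M 1 1, ?_⟩
  ext i j
  fin_cases i <;> fin_cases j <;> simp [hd, h01, h10]

lemma eq_zero_of_mul_eq_mul_star {x y : ℝ} (hxy : |x| ≠ |y|) {z : ℂ} (h : x * z = y * star z) :
    z = 0 := by
  have := congrArg norm h
  rw [norm_mul, norm_mul, norm_star, Complex.norm_real, Complex.norm_real, Real.norm_eq_abs,
    Real.norm_eq_abs] at this
  by_contra hz
  exact hxy (mul_right_cancel₀ (norm_ne_zero_iff.2 hz) this)

lemma eq_zero_of_rotation {γ : ℝ} {x y : ℂ}
    (h₁ : ((Real.cos γ : ℝ) : ℂ) * x + ((Real.sin γ : ℝ) : ℂ) * y = 0)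
    (h₂ : ((Real.sin γ : ℝ) : ℂ) * x - ((Real.cos γ : ℝ) : ℂ) * y = 0) : x = 0 ∧ y = 0 := by
  have hc : ((Real.cos γ : ℝ) : ℂ) ^ 2 + ((Real.sin γ : ℝ) : ℂ) ^ 2 = 1 := by
    exact_mod_cast Real.cos_sq_add_sin_sq γ
  constructor
  · linear_combination ((Real.cos γ : ℝ) : ℂ) * h₁ + ((Real.sin γ : ℝ) : ℂ) * h₂ - x * hc
  · linear_combination ((Real.sin γ : ℝ) : ℂ) * h₁ - ((Real.cos γ : ℝ) : ℂ) * h₂ - y * hc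

/-- Orthogonality of `Ψ₁` to `Ψ₂` and `Ψ₃` suffices. Undoing the mixing by `γ` gives conditions
against `Ψ(α - π/2)` and `Φ(β - π/2)`: the first equates the diagonal entries of `M`, the second
relates `M 0 1` to its conjugate with coefficients of different modulus, so it vanishes. The moduli
differ because `cos (α + β) > 0` for Alice and `sin (β - α) > 0` for Bob; the latter is where `α <
β` is essential. -/
theorem not_loccDistinguishable_basisState {α β γ : ℝ} (hα : 0 < α) (hαβ : α < β)
    (hβ : β ≤ Real.pi / 4) : ¬ LOCCDistinguishable fun k => pureOp (basisState α β γ k) := by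
  have hpi := Real.pi_pos
  have hsα : 0 < Real.sin α := Real.sin_pos_of_pos_of_lt_pi hα (by linarith)
  have hsβ : 0 < Real.sin β := Real.sin_pos_of_pos_of_lt_pi (by linarith) (by linarith)
  have hcα : 0 < Real.cos α := Real.cos_pos_of_mem_Ioo ⟨by linarith, by linarith⟩
  have hcβ : 0 < Real.cos β := Real.cos_pos_of_mem_Ioo ⟨by linarith, by linarith⟩
  have hadd : 0 < Real.cos (α + β) := Real.cos_pos_of_mem_Ioo ⟨by linarith, by linarith⟩
  have hsub : 0 < Real.sin (β - α) := Real.sin_pos_of_pos_of_lt_pi (by linarith) (by linarith)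
  rw [Real.cos_add] at hadd
  rw [Real.sin_sub] at hsub
  have hsc : ((Real.cos α * Real.sin α : ℝ) : ℂ) ≠ 0 := by
    exact_mod_cast (mul_pos hcα hsα).ne'
  refine not_loccDistinguishable_of_scalar _ (orthonormal_basisState α β γ).ne_zero
    (fun M hM h => ?_) (fun M hM h => ?_)
  · have h₁ := h 0 1 (by decide)
    have h₂ := h 0 2 (by decide)
    simp [dotProduct, mulVec, Fintype.sum_prod_type, Fin.sum_univ_two, kroneckerMap_apply,
      basisState_zero_apply, basisState_one_apply, basisState_two_apply, -Complex.ofReal_cos,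
      -Complex.ofReal_sin] at h₁ h₂
    obtain ⟨hx, hy⟩ := eq_zero_of_rotation (γ := γ)
      (x := ((Real.cos α * Real.sin α : ℝ) : ℂ) * (M 0 0 - M 1 1))
      (y := ((Real.sin α * Real.sin β : ℝ) : ℂ) * M 1 0
        - ((Real.cos α * Real.cos β : ℝ) : ℂ) * M 0 1)
      (by push_cast [-Complex.ofReal_cos, -Complex.ofReal_sin]; linear_combination h₁)
      (by push_cast [-Complex.ofReal_cos, -Complex.ofReal_sin]; linear_combination h₂)
    refine eq_smul_one_of_entries (sub_eq_zero.1 ((mul_eq_zero.1 hx).resolve_left hsc))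
      (eq_zero_of_mul_eq_mul_star ?_ (?_ : ((Real.cos α * Real.cos β : ℝ) : ℂ) * M 0 1 =
        ((Real.sin α * Real.sin β : ℝ) : ℂ) * star (M 0 1))) hM
    · rw [abs_of_pos (mul_pos hcα hcβ), abs_of_pos (mul_pos hsα hsβ)]
      linarith
    · rw [hM.apply 1 0]
      linear_combination -hy
  · have h₁ := h 0 1 (by decide)
    have h₂ := h 0 2 (by decide)
    simp [dotProduct, mulVec, Fintype.sum_prod_type, Fin.sum_univ_two, kroneckerMap_apply,
      basisState_zero_apply, basisState_one_apply, basisState_two_apply, -Complex.ofReal_cos,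
      -Complex.ofReal_sin] at h₁ h₂
    obtain ⟨hx, hy⟩ := eq_zero_of_rotation (γ := γ)
      (x := ((Real.cos α * Real.sin α : ℝ) : ℂ) * (M 1 1 - M 0 0))
      (y := ((Real.cos α * Real.sin β : ℝ) : ℂ) * M 1 0
        - ((Real.sin α * Real.cos β : ℝ) : ℂ) * M 0 1)
      (by push_cast [-Complex.ofReal_cos, -Complex.ofReal_sin]; linear_combination h₁)
      (by push_cast [-Complex.ofReal_cos, -Complex.ofReal_sin]; linear_combination h₂)
    refine eq_smul_one_of_entries (sub_eq_zero.1 ((mul_eq_zero.1 hx).resolve_left hsc)).symm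
      (eq_zero_of_mul_eq_mul_star ?_ (?_ : ((Real.sin α * Real.cos β : ℝ) : ℂ) * M 0 1 =
        ((Real.cos α * Real.sin β : ℝ) : ℂ) * star (M 0 1))) hM
    · rw [abs_of_pos (mul_pos hsα hcβ), abs_of_pos (mul_pos hcα hsβ)]
      linarith
    · rw [hM.apply 1 0]
      linear_combination -hy

/-! ### An explicit triple distinguishable by LOCC -/

/-- The protocol in which both parties measure in the computational basis and announce a function
of the two results. -/
noncomputable def Protocol.measureBasis {O : Type} (f : Fin 2 → Fin 2 → O) : Protocol 2 2 O 2 2 :=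
  .alice (fun _ : Fin 2 => 2) (fun i => Matrix.single i i 1) (by simp [Matrix.sum_single_one])
    fun i =>
    .bob (fun _ : Fin 2 => 2) (fun j => Matrix.single j j 1) (by simp [Matrix.sum_single_one])
      fun j =>
        .halt (f i j)

lemma isSeparableState_pureOp {m n : ℕ} {ψ : Space m n} (h : ‖ψ‖ = 1) (hψ : IsProduct ψ) :
    IsSeparableState (pureOp ψ) :=
  ⟨1, fun _ => 1, fun _ => ψ, by simp, by simp, fun _ => ⟨h, hψ⟩, by simp⟩

lemma isSeparableState_ket (i j : Fin 2) : IsSeparableState (pureOp (ket i j)) := by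
  refine isSeparableState_pureOp (by simp [ket])
    ⟨EuclideanSpace.single i 1, EuclideanSpace.single j 1, fun k l => ?_⟩
  by_cases hk : k = i <;> simp [ket, Prod.ext_iff, hk]

lemma loccDistinguishable_ket :
    LOCCDistinguishable fun k : Fin 3 => pureOp (![ket 0 0, ket 0 1, ket 1 0] k) := by
  -- The result `11` never occurs for these states, so its label is arbitrary.
  refine ⟨2, 2, Protocol.measureBasis ![![0, 1], ![2, 2]], fun k j => ?_⟩
  fin_cases k <;> fin_cases j <;>
    simp [Protocol.measureBasis, Protocol.run, Fin.sum_univ_two, Matrix.trace, Matrix.mul_apply,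
      Fintype.sum_prod_type, kroneckerMap_apply, pureOp, ket, Matrix.single_apply, Matrix.one_apply]

end SepLOCC

theorem mainTheorem4 :
    (∀ α β γ : ℝ, 0 < α → α ≤ β → β ≤ Real.pi / 4 →
      SepLOCC.gammaMin α β ≤ γ → γ ≤ SepLOCC.gammaMax α β →
      -- an orthonormal basis of the orthogonal complement of `|Φ(β)⟩`
      (‖SepLOCC.phi β‖ = 1 ∧
        Orthonormal ℂ (SepLOCC.basisState α β γ) ∧
        Submodule.span ℂ (Set.range (SepLOCC.basisState α β γ)) =
          (Submodule.span ℂ {SepLOCC.phi β})ᗮ) ∧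
      -- which of the basis states are product states
      (¬ SepLOCC.IsProduct (SepLOCC.basisState α β γ 0) ∧
        (SepLOCC.IsProduct (SepLOCC.basisState α β γ 1) ↔ γ = SepLOCC.gammaMin α β) ∧
        (SepLOCC.IsProduct (SepLOCC.basisState α β γ 2) ↔ γ = SepLOCC.gammaMax α β)) ∧
      -- perfectly distinguishable by separable operations
      SepLOCC.SepDistinguishable (fun k => SepLOCC.pureOp (SepLOCC.basisState α β γ k)) ∧
      (α < β →
        -- not perfectly distinguishable by LOCC
        ¬ SepLOCC.LOCCDistinguishable
            (fun k => SepLOCC.pureOp (SepLOCC.basisState α β γ k)) ∧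
        -- the resulting separable operations that are not realizable by LOCC
        ∀ σ : Fin 3 → SepLOCC.Op 2 2, (∀ k, SepLOCC.IsSeparableState (σ k)) →
          SepLOCC.LOCCDistinguishable σ →
          ∃ F : SepLOCC.Op 2 2 →ₗ[ℂ] SepLOCC.Op 2 2,
            SepLOCC.IsSeparableOperation F ∧
            (∀ k, F (SepLOCC.pureOp (SepLOCC.basisState α β γ k)) = σ k) ∧
            ¬ SepLOCC.IsLOCC F)) ∧
    ∃ F : SepLOCC.Op 2 2 →ₗ[ℂ] SepLOCC.Op 2 2,
      SepLOCC.IsSeparableOperation F ∧ ¬ SepLOCC.IsLOCC F := by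
  refine ⟨fun α β γ hα hαβ hβ hγ hγ' => ?_, ?_⟩
  · obtain ⟨ha, hb, ⟨-, h1⟩, -, h2⟩ := SepLOCC.coeffDet_signs hα hαβ hβ hγ hγ'
    have hsep := SepLOCC.sepDistinguishable_basisState hα hαβ hβ hγ hγ'
    refine ⟨⟨SepLOCC.norm_phi β, SepLOCC.orthonormal_basisState α β γ,
      SepLOCC.span_basisState α β γ⟩, ⟨?_, ?_, ?_⟩, hsep, fun hlt => ?_⟩
    · rw [SepLOCC.isProduct_iff_coeffDet, SepLOCC.coeffDet_basisState, Complex.ofReal_eq_zero]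
      simpa using ha.ne'
    · rw [SepLOCC.isProduct_iff_coeffDet, SepLOCC.coeffDet_basisState, Complex.ofReal_eq_zero,
        ← h1]
      simp [sub_eq_zero]
    · rw [SepLOCC.isProduct_iff_coeffDet, SepLOCC.coeffDet_basisState, Complex.ofReal_eq_zero,
        ← h2]
      simp [sub_eq_zero]
    · have hlocc := SepLOCC.not_loccDistinguishable_basisState (γ := γ) hα hlt hβ
      exact ⟨hlocc, fun σ hσ hσ' => SepLOCC.exists_separable_not_locc hsep hlocc hσ hσ'⟩
  -- Any admissible parameters with `α < β` would do; here `α = π/8`, `β = π/4` and `γ = γ₋`.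
  · have hα : 0 < Real.pi / 8 := by positivity
    have hαβ : Real.pi / 8 < Real.pi / 4 := by linarith
    obtain ⟨F, hF, -, hF'⟩ := SepLOCC.exists_separable_not_locc
      (SepLOCC.sepDistinguishable_basisState hα hαβ.le le_rfl le_rfl
        (SepLOCC.gammaMin_le_gammaMax hα hαβ.le le_rfl))
      (SepLOCC.not_loccDistinguishable_basisState hα hαβ le_rfl)
      (fun k => by fin_cases k <;> exact SepLOCC.isSeparableState_ket _ _)
      SepLOCC.loccDistinguishable_ket
    exact ⟨F, hF, hF'⟩
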